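/- All graphs are finite, simple and undirected. A graph is Hamiltonian if it contains a cycle through all of its vertices. A graph $G$ is $1$-tough if $|S|\ge c(G-S)$ for every $S\subseteq V(G)$ with $c(G-S)\ge 2$, where $c(G-S)$ is the number of connected components of the subgraph of $G$ induced on $V(G)\setminus S$. A path factor of $G$ is a spanning subgraph of $G$ each of whose connected components is isomorphic to a path of order at least two. Let $P_n$ be the path of order $n$, let $\Delta(H)$ be the maximum degree of $H$, and let $G_1\square G_2$ be the Cartesian product of graphs, with vertex set $V(G_1)\times V(G_2)$, in which $(v,u)$ and $(v',u')$ are adjacent if and only if either $v=v'$ and $uu'\in E(G_2)$, or $u=u'$ and $vv'\in E(G_1)$. Let $H$ be a connected bipartite graph and let $n$ be an even non-negative integer with $n\ge 4\Delta(H)-2$. Assume that $P_n\square H$ has at least three vertices, i.e. $n\,|V(H)|\ge 3$. Then the following three statements are equivalent: (1) $P_n\square H$ is Hamiltonian; (2) $P_n\square H$ is $1$-tough; (3) $H$ has a path factor. -/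

import Mathlib

namespace SimpleGraph

/-- `F` is a path factor of `G`: a spanning subgraph of `G` (the vertex set is all of `V`, and every
edge of `F` is an edge of `G`) such that each connected component of `F` is isomorphic to a path
of order at least two. -/
def IsPathFactor {V : Type*} (G F : SimpleGraph V) : Prop :=
  F ≤ G ∧ ∀ c : F.ConnectedComponent, ∃ k : ℕ, 2 ≤ k ∧ Nonempty (c.toSimpleGraph ≃g pathGraph k)

/-- The number `c(G - S)` of connected components of the subgraph of `G` induced on `V \ S`. -/
noncomputable def numComponentsCompl {V : Type*} [Fintype V] (G : SimpleGraph V)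
    (S : Finset V) : ℕ :=
  Nat.card (G.induce ((S : Set V)ᶜ)).ConnectedComponent

/-- A finite graph `G` is `t`-tough if `|S| ≥ t * c(G - S)` for every cut set `S`, that is, for
every set `S` of vertices with `c(G - S) ≥ 2`. -/
def IsTough {V : Type*} [Fintype V] (G : SimpleGraph V) (t : ℚ) : Prop :=
  ∀ S : Finset V, 2 ≤ G.numComponentsCompl S → t * (G.numComponentsCompl S : ℚ) ≤ (S.card : ℚ)

end SimpleGraph

namespace SimpleGraph

variable {V : Type*}

/-- A Hamiltonian cycle enters a vertex of `S` when it leaves a component of `G - S`. -/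
theorem Walk.IsHamiltonianCycle.numComponentsCompl_le [Fintype V] [DecidableEq V]
    {G : SimpleGraph V} {a : V} {p : G.Walk a a} (hp : p.IsHamiltonianCycle) (S : Finset V)
    (hS : 2 ≤ G.numComponentsCompl S) : G.numComponentsCompl S ≤ S.card := by
  classical
  let mem : (G.induce ((S : Set V)ᶜ)).ConnectedComponent → V → Prop := fun K v =>
    ∃ h : v ∈ (S : Set V)ᶜ, (G.induce ((S : Set V)ᶜ)).connectedComponentMk ⟨v, h⟩ = K
  have hex : ∀ K, ∃ i < p.length, mem K (p.getVert i) ∧ ¬ mem K (p.getVert (i + 1)) := by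
    intro K
    by_contra! hcon
    have hnt : Nontrivial (G.induce ((S : Set V)ᶜ)).ConnectedComponent := by
      apply Finite.one_lt_card_iff_nontrivial.mp
      exact hS
    obtain ⟨K', hK'⟩ := exists_ne K
    obtain ⟨⟨v, hv⟩, rfl⟩ := K.nonempty_supp
    obtain ⟨⟨w, hw⟩, rfl⟩ := K'.nonempty_supp
    obtain ⟨j, hj, hjl⟩ := Walk.mem_support_iff_exists_getVert.mp (hp.mem_support v)
    obtain ⟨k, hk, hkl⟩ := Walk.mem_support_iff_exists_getVert.mp (hp.mem_support w)
    have step : ∀ i, mem (connectedComponentMk _ ⟨v, hv⟩) (p.getVert i) → ∀ d,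
        i + d ≤ p.length → mem (connectedComponentMk _ ⟨v, hv⟩) (p.getVert (i + d)) := by
      intro i hi d
      induction d with
      | zero => intro _; exact hi
      | succ d ih => intro hd; exact hcon (i + d) (by omega) (ih (by omega))
    have h0 : mem (connectedComponentMk _ ⟨v, hv⟩) (p.getVert 0) := by
      have := step j (by rw [hj]; exact ⟨hv, rfl⟩) (p.length - j) (by omega)
      rw [show j + (p.length - j) = p.length by omega, Walk.getVert_length] at this
      rwa [Walk.getVert_zero]
    have := step 0 h0 k (by omega)
    rw [Nat.zero_add, hk] at this
    exact hK' this.2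
  choose f hf hfm hfn using hex
  have hfS : ∀ K, p.getVert (f K + 1) ∈ S := by
    intro K
    by_contra hn
    obtain ⟨h1, h2⟩ := hfm K
    refine hfn K ⟨by simpa using hn, ?_⟩
    refine Eq.trans ?_ h2
    rw [ConnectedComponent.eq]
    exact (Adj.reachable (by simpa using (p.adj_getVert_succ (hf K)).symm))
  have hinj : Function.Injective fun K => (⟨p.getVert (f K + 1), hfS K⟩ : S) := by
    intro K K' h
    have h1 : p.getVert (f K + 1) = p.getVert (f K' + 1) := congrArg Subtype.val h
    have h2 := hp.isCycle.getVert_injOn (by simp; have := hf K; omega)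
      (by simp; have := hf K'; omega) h1
    have h3 : f K = f K' := by omega
    obtain ⟨x, hx⟩ := hfm K
    obtain ⟨y, hy⟩ := hfm K'
    rw [← hx, ← hy]
    congr 2
    rw [h3]
  have := Nat.card_le_card_of_injective _ hinj
  simpa [numComponentsCompl] using this

theorem IsHamiltonian.isTough_one [Fintype V] [DecidableEq V] {G : SimpleGraph V}
    (hG : G.IsHamiltonian) (hcard : Fintype.card V ≠ 1) : G.IsTough 1 := by
  obtain ⟨a, p, hp⟩ := hG hcard
  intro S hS
  rw [one_mul]
  exact_mod_cast hp.numComponentsCompl_le S hS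

/-- Deleting an edge of a cycle leaves a path. -/
theorem Walk.IsCycle.exists_isPath_of_mem_edges {G : SimpleGraph V} {u a b : V} {p : G.Walk u u}
    (hp : p.IsCycle) (hab : s(a, b) ∈ p.edges) :
    ∃ q : G.Walk a b, q.IsPath ∧ (∀ v, v ∈ q.support ↔ v ∈ p.support) ∧
      (∀ e ∈ p.edges, e ≠ s(a, b) → e ∈ q.edges) ∧ 2 ≤ q.length := by
  have split : ∀ {x y : V} (w : G.Walk x y), s(a, b) ∈ w.edges →
      (∃ (h : G.Adj a b) (w₁ : G.Walk x a) (w₂ : G.Walk b y), w = w₁.append (.cons h w₂)) ∨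
      (∃ (h : G.Adj b a) (w₁ : G.Walk x b) (w₂ : G.Walk a y), w = w₁.append (.cons h w₂)) := by
    intro x y w
    induction w with
    | nil => simp
    | @cons x z y h w ih =>
      intro hw
      rw [Walk.edges_cons, List.mem_cons] at hw
      rcases hw with hw | hw
      · rcases Sym2.eq_iff.mp hw with ⟨rfl, rfl⟩ | ⟨rfl, rfl⟩
        · exact Or.inl ⟨h, .nil, w, rfl⟩
        · exact Or.inr ⟨h, .nil, w, rfl⟩
      · rcases ih hw with ⟨h', w₁, w₂, rfl⟩ | ⟨h', w₁, w₂, rfl⟩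
        · exact Or.inl ⟨h', .cons h w₁, w₂, rfl⟩
        · exact Or.inr ⟨h', .cons h w₁, w₂, rfl⟩
  have key : ∀ {a b : V} (h : G.Adj a b) (w₁ : G.Walk u a) (w₂ : G.Walk b u),
      p = w₁.append (.cons h w₂) → ∃ q : G.Walk b a, q.IsPath ∧
      (∀ v, v ∈ q.support ↔ v ∈ p.support) ∧
      (∀ e ∈ p.edges, e ≠ s(a, b) → e ∈ q.edges) ∧ 2 ≤ q.length := by
    rintro a b h w₁ w₂ rfl
    refine ⟨w₂.append w₁, ?_, ?_, ?_, ?_⟩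
    · rw [Walk.isPath_def, Walk.support_append]
      have := hp.support_nodup
      rw [Walk.tail_support_append, Walk.support_cons, List.tail_cons] at this
      exact (List.perm_append_comm.nodup_iff).mp this
    · intro v
      simp only [Walk.mem_support_append_iff, Walk.support_cons, List.mem_cons]
      constructor
      · tauto
      · rintro (h | rfl | h)
        · exact Or.inr h
        · exact Or.inr w₁.end_mem_support
        · exact Or.inl h
    · intro e
      simp only [Walk.edges_append, Walk.edges_cons, List.mem_append, List.mem_cons]
      tauto
    · have := hp.three_le_length
      simp only [Walk.length_append, Walk.length_cons] at this ⊢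
      omega
  rcases split p hab with ⟨h, w₁, w₂, hw⟩ | ⟨h, w₁, w₂, hw⟩
  · obtain ⟨q, h1, h2, h3, h4⟩ := key h w₁ w₂ hw
    exact ⟨q.reverse, h1.reverse, by simpa using h2, by simpa using h3, by simpa using h4⟩
  · obtain ⟨q, h1, h2, h3, h4⟩ := key h w₁ w₂ hw
    exact ⟨q, h1, h2, by simpa [Sym2.eq_swap] using h3, h4⟩

/-- Two disjoint cycles are merged by exchanging an edge of each for two edges between them. -/
theorem Walk.IsCycle.exists_merge {G : SimpleGraph V} {u u' a b a' b' : V} {p : G.Walk u u}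
    {p' : G.Walk u' u'} (hp : p.IsCycle) (hp' : p'.IsCycle)
    (hdisj : ∀ v ∈ p.support, v ∉ p'.support) (hab : s(a, b) ∈ p.edges)
    (hab' : s(a', b') ∈ p'.edges) (ha : G.Adj a a') (hb : G.Adj b b') :
    ∃ (x : V) (r : G.Walk x x), r.IsCycle ∧
      (∀ v, v ∈ r.support ↔ v ∈ p.support ∨ v ∈ p'.support) ∧
      (∀ e ∈ p.edges, e ≠ s(a, b) → e ∈ r.edges) ∧
      (∀ e ∈ p'.edges, e ≠ s(a', b') → e ∈ r.edges) ∧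
      s(a, a') ∈ r.edges ∧ s(b, b') ∈ r.edges := by
  obtain ⟨q, hq, hqs, hqe, hql⟩ := hp.exists_isPath_of_mem_edges hab
  obtain ⟨q', hq', hqs', hqe', hql'⟩ := hp'.exists_isPath_of_mem_edges hab'
  have hpath : (q.append (.cons hb q'.reverse)).IsPath := by
    rw [Walk.isPath_def, Walk.support_append, Walk.support_cons, List.tail_cons,
      Walk.support_reverse, List.nodup_append']
    refine ⟨hq.support_nodup, List.nodup_reverse.mpr hq'.support_nodup, ?_⟩
    intro v hv hv'
    rw [List.mem_reverse, hqs'] at hv'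
    exact hdisj v ((hqs v).mp hv) hv'
  have hasup : a ∈ p.support := (hqs a).mp q.start_mem_support
  have hbsup : b ∈ p.support := (hqs b).mp q.end_mem_support
  have hasup' : a' ∈ p'.support := (hqs' a').mp q'.start_mem_support
  have hne : a ≠ b := by
    rintro rfl
    have := Walk.length_eq_zero_iff.mpr (Walk.isPath_iff_nil.mp hq)
    omega
  refine ⟨a', .cons ha.symm (q.append (.cons hb q'.reverse)), ?_, ?_, ?_, ?_, ?_, ?_⟩
  · rw [Walk.cons_isCycle_iff]
    refine ⟨hpath, ?_⟩
    simp only [Walk.edges_append, Walk.edges_cons, List.mem_append, List.mem_cons,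
      Walk.edges_reverse, List.mem_reverse]
    rintro (h | h | h)
    · exact hdisj a' ((hqs _).mp (q.fst_mem_support_of_mem_edges h)) hasup'
    · rcases Sym2.eq_iff.mp h with ⟨h, -⟩ | ⟨-, h⟩
      · exact hdisj b hbsup (h ▸ hasup')
      · exact hne h
    · exact hdisj a hasup ((hqs' _).mp (q'.snd_mem_support_of_mem_edges h))
  · intro v
    simp only [Walk.support_cons, List.mem_cons, Walk.mem_support_append_iff,
      Walk.support_reverse, List.mem_reverse, hqs, hqs']
    constructor
    · rintro (rfl | h | rfl | h)
      exacts [Or.inr hasup', Or.inl h, Or.inl hbsup, Or.inr h]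
    · tauto
  · intro e he hne
    simp [hqe e he hne]
  · intro e he hne
    simp [hqe' e he hne]
  · simp [Sym2.eq_swap]
  · simp

end SimpleGraph

namespace SimpleGraph

variable {V : Type*}

theorem IsBipartite.exists_adj_imp_mem_iff_notMem {H : SimpleGraph V} (h : H.IsBipartite) :
    ∃ A : Set V, ∀ u v, H.Adj u v → (u ∈ A ↔ v ∉ A) := by
  obtain ⟨c⟩ := h
  refine ⟨{v | c v = 0}, fun u v huv => ?_⟩
  have := c.valid huv
  simp only [Set.mem_ofPred_eq]
  omega

/-- A self-map swapping the two sides `A` and `Aᶜ` has a kernel. -/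
theorem exists_kernel_of_swap (A : Set V) (h : V → V) (hA : ∀ v, v ∈ A ↔ h v ∉ A) :
    ∃ N : Set V, (∀ v ∈ N, h v ∉ N) ∧ ∀ v ∉ N, ∃ u ∈ N, h u = v := by
  let Φ : Set V →o Set V :=
    ⟨fun X => {a | a ∈ A ∧ ∀ b, b ∉ A → h b = a → ∃ a' ∈ X, h a' = b},
      fun X Y hXY a ha => ⟨ha.1, fun b hb hba =>
        let ⟨a', h1, h2⟩ := ha.2 b hb hba
        ⟨a', hXY h1, h2⟩⟩⟩
  obtain ⟨X, hX⟩ : ∃ X, Φ X = X := ⟨_, Φ.map_lfp⟩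
  have hmem : ∀ a, a ∈ X ↔ a ∈ A ∧ ∀ b, b ∉ A → h b = a → ∃ a' ∈ X, h a' = b := by
    intro a
    conv_lhs => rw [← hX]
    rfl
  refine ⟨X ∪ {b | b ∉ A ∧ ∀ a' ∈ X, h a' ≠ b}, ?_, ?_⟩
  · rintro v (hv | ⟨hv, hv'⟩)
    · have hvA := ((hmem v).mp hv).1
      rintro (hh | ⟨-, hh⟩)
      · exact (hA v).mp hvA ((hmem _).mp hh).1
      · exact hh v hv rfl
    · rintro (hh | ⟨hh, -⟩)
      · obtain ⟨a', h1, h2⟩ := ((hmem _).mp hh).2 v hv rfl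
        exact hv' a' h1 h2
      · exact hv ((hA v).mpr hh)
  · intro v hv
    simp only [Set.mem_union, Set.mem_ofPred_eq, not_or, not_and, not_forall, not_not] at hv
    obtain ⟨hv1, hv2⟩ := hv
    by_cases hvA : v ∈ A
    · rw [hmem] at hv1
      push Not at hv1
      obtain ⟨b, hb, hbv, hb'⟩ := hv1 hvA
      exact ⟨b, Or.inr ⟨hb, hb'⟩, hbv⟩
    · obtain ⟨a', h1, h2⟩ := hv2 hvA
      exact ⟨a', Or.inl h1, h2⟩

/-- A spanning family of stars with one or two leaves: `leaves` is the set of leaves, `center` sends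
a leaf to the centre of its star, and `label` distinguishes the leaves of the same star. -/
structure ShortStarFactor (H : SimpleGraph V) where
  leaves : Set V
  center : V → V
  label : V → Bool
  adj_center : ∀ v, H.Adj v (center v)
  center_notMem : ∀ v ∈ leaves, center v ∉ leaves
  exists_leaf : ∀ v ∉ leaves, ∃ u ∈ leaves, center u = v
  label_injective : ∀ u v, center u = center v → label u = label v → u = v

theorem IsBipartite.nonempty_shortStarFactor {H : SimpleGraph V} (hb : H.IsBipartite)
    {f : V → V × Bool} (hf : Function.Injective f) (hadj : ∀ v, H.Adj v (f v).1) :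
    Nonempty H.ShortStarFactor := by
  obtain ⟨A, hA⟩ := hb.exists_adj_imp_mem_iff_notMem
  obtain ⟨N, h1, h2⟩ := exists_kernel_of_swap A (fun v => (f v).1) fun v => hA _ _ (hadj v)
  exact ⟨⟨N, fun v => (f v).1, fun v => (f v).2, hadj, h1, h2,
    fun u v h h' => hf (Prod.ext h h')⟩⟩

/-- Orienting every path of a path factor, each vertex is sent to its successor, the last one to its
predecessor. -/
theorem IsPathFactor.exists_injective {H F : SimpleGraph V} (hF : H.IsPathFactor F) :
    ∃ f : V → V × Bool, Function.Injective f ∧ ∀ v, H.Adj v (f v).1 := by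
  obtain ⟨hle, hcomp⟩ := hF
  have hc : ∀ c : F.ConnectedComponent, ∃ g : c → c × Bool, Function.Injective g ∧
      ∀ v : c, F.Adj v (g v).1 := by
    intro c
    obtain ⟨k, hk, ⟨φ⟩⟩ := hcomp c
    let nx : Fin k → Fin k × Bool := fun i =>
      if h : i.val + 1 < k then (⟨i + 1, h⟩, true) else (⟨i - 1, by omega⟩, false)
    have hnx : Function.Injective nx := by
      intro i j hij
      simp only [nx] at hij
      split_ifs at hij <;> simp at hij <;> omega
    refine ⟨fun v => (φ.symm (nx (φ v)).1, (nx (φ v)).2), ?_, ?_⟩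
    · intro u v huv
      simp only [Prod.mk.injEq, EmbeddingLike.apply_eq_iff_eq] at huv
      exact φ.injective (hnx (Prod.ext huv.1 huv.2))
    · intro v
      have : c.toSimpleGraph.Adj v (φ.symm (nx (φ v)).1) := by
        rw [← φ.map_adj_iff, RelIso.apply_symm_apply, pathGraph_adj]
        simp only [nx]
        split_ifs
        · exact Or.inl rfl
        · right
          simp only
          omega
      exact this
  choose g hg hga using hc
  refine ⟨fun v => ((g (F.connectedComponentMk v) ⟨v, rfl⟩).1,
    (g (F.connectedComponentMk v) ⟨v, rfl⟩).2), ?_, fun v => hle (hga (F.connectedComponentMk v) ⟨v, rfl⟩)⟩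
  intro u v huv
  simp only [Prod.mk.injEq] at huv
  have hcc : F.connectedComponentMk u = F.connectedComponentMk v := by
    have h1 := (ConnectedComponent.mem_supp_iff _ _).mp
      (g (F.connectedComponentMk u) ⟨u, rfl⟩).1.2
    have h2 := (ConnectedComponent.mem_supp_iff _ _).mp
      (g (F.connectedComponentMk v) ⟨v, rfl⟩).1.2
    rw [← h1, ← h2, huv.1]
  have key : ∀ (c : F.ConnectedComponent) (hu : F.connectedComponentMk u = c)
      (hv : F.connectedComponentMk v = c), u = v := by
    intro c hu hv
    have e1 : ∀ (w : V) (hw : F.connectedComponentMk w = c),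
        (((g (F.connectedComponentMk w) ⟨w, rfl⟩).1 : V),
          (g (F.connectedComponentMk w) ⟨w, rfl⟩).2) = (((g c ⟨w, hw⟩).1 : V), (g c ⟨w, hw⟩).2) := by
      rintro w rfl
      rfl
    have h3 : (((g c ⟨u, hu⟩).1 : V), (g c ⟨u, hu⟩).2) = (((g c ⟨v, hv⟩).1 : V), (g c ⟨v, hv⟩).2) := by
      rw [← e1 u hu, ← e1 v hv, huv.1, huv.2]
    rw [Prod.mk.injEq] at h3
    have := hg c (Prod.ext (Subtype.ext h3.1) h3.2)
    exact congrArg Subtype.val this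
  exact key _ hcc rfl

namespace ShortStarFactor

variable {H : SimpleGraph V} (S : H.ShortStarFactor)

/-- The centre of the star containing `v`. -/
noncomputable def root (v : V) : V := by
  classical exact if v ∈ S.leaves then S.center v else v

theorem root_of_mem {v : V} (hv : v ∈ S.leaves) : S.root v = S.center v := if_pos hv

theorem root_of_notMem {v : V} (hv : v ∉ S.leaves) : S.root v = v := if_neg hv

theorem root_notMem (v : V) : S.root v ∉ S.leaves := by
  by_cases hv : v ∈ S.leaves
  · rw [S.root_of_mem hv]
    exact S.center_notMem v hv
  · rwa [S.root_of_notMem hv]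

theorem root_eq_iff {c : V} (hc : c ∉ S.leaves) {v : V} :
    S.root v = c ↔ v = c ∨ v ∈ S.leaves ∧ S.center v = c := by
  by_cases hv : v ∈ S.leaves
  · rw [S.root_of_mem hv]
    constructor
    · exact fun h => Or.inr ⟨hv, h⟩
    · rintro (rfl | h)
      exacts [(hc hv).elim, h.2]
  · rw [S.root_of_notMem hv]
    simp [hv]

/-- Every star has one or two leaves. -/
theorem leaves_cases {c : V} (hc : c ∉ S.leaves) :
    (∃ x ∈ S.leaves, S.center x = c ∧ ∀ v, S.root v = c ↔ v = x ∨ v = c) ∨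
    ∃ x ∈ S.leaves, ∃ y ∈ S.leaves, x ≠ y ∧ S.center x = c ∧ S.center y = c ∧
      ∀ v, S.root v = c ↔ v = x ∨ v = c ∨ v = y := by
  obtain ⟨x, hx, hxc⟩ := S.exists_leaf c hc
  by_cases h : ∃ y ∈ S.leaves, S.center y = c ∧ y ≠ x
  · obtain ⟨y, hy, hyc, hne⟩ := h
    refine Or.inr ⟨x, hx, y, hy, hne.symm, hxc, hyc, fun v => ?_⟩
    rw [S.root_eq_iff hc]
    constructor
    · rintro (h | ⟨hv, h⟩)
      · tauto
      · have h1 := S.label_injective v x (h.trans hxc.symm)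
        have h2 := S.label_injective v y (h.trans hyc.symm)
        have h3 := S.label_injective x y (hxc.trans hyc.symm)
        cases hlv : S.label v <;> cases hlx : S.label x <;> cases hly : S.label y <;> simp_all
    · rintro (rfl | rfl | rfl) <;> tauto
  · push Not at h
    refine Or.inl ⟨x, hx, hxc, fun v => ?_⟩
    rw [S.root_eq_iff hc]
    constructor
    · rintro (h' | ⟨hv, h'⟩)
      · exact Or.inr h'
      · exact Or.inl (h v hv h')
    · rintro (rfl | rfl) <;> tauto

/-- The spanning subgraph formed by the stars. -/
def graph : SimpleGraph V where
  Adj u v := (u ∈ S.leaves ∧ S.center u = v) ∨ (v ∈ S.leaves ∧ S.center v = u)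
  symm := ⟨fun _ _ h => h.symm⟩
  loopless := ⟨fun u h => (S.adj_center u).ne (by tauto)⟩

theorem root_eq_of_adj {u v : V} (h : S.graph.Adj u v) : S.root u = S.root v := by
  rcases h with ⟨h, rfl⟩ | ⟨h, rfl⟩
  · rw [S.root_of_mem h, S.root_of_notMem (S.center_notMem _ h)]
  · rw [S.root_of_mem h, S.root_of_notMem (S.center_notMem _ h)]

theorem connectedComponentMk_eq_iff {u v : V} :
    S.graph.connectedComponentMk u = S.graph.connectedComponentMk v ↔ S.root u = S.root v := by
  rw [ConnectedComponent.eq]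
  have hroot : ∀ v, S.graph.Reachable v (S.root v) := by
    intro v
    by_cases hv : v ∈ S.leaves
    · rw [S.root_of_mem hv]
      exact Adj.reachable (Or.inl ⟨hv, rfl⟩)
    · rw [S.root_of_notMem hv]
  constructor
  · rintro ⟨p⟩
    induction p with
    | nil => rfl
    | cons h _ ih => rw [S.root_eq_of_adj h, ih]
  · intro h
    exact (hroot u).trans (h ▸ (hroot v).symm)

theorem isPathFactor_graph : H.IsPathFactor S.graph := by
  refine ⟨fun u v h => ?_, fun c => ?_⟩
  · rcases h with ⟨-, rfl⟩ | ⟨-, rfl⟩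
    exacts [S.adj_center u, (S.adj_center v).symm]
  · obtain ⟨v, rfl⟩ := c.exists_rep
    have hiso : ∀ (k : ℕ) (f : Fin k → V), Function.Injective f →
        (∀ u, S.root u = S.root v ↔ u ∈ Set.range f) →
        (∀ i j, S.graph.Adj (f i) (f j) ↔ (pathGraph k).Adj i j) →
        Nonempty ((S.graph.connectedComponentMk v).toSimpleGraph ≃g pathGraph k) := by
      intro k f hf hr ha
      have hm : ∀ u, u ∈ (S.graph.connectedComponentMk v).supp ↔ u ∈ Set.range f := by
        intro u
        rw [ConnectedComponent.mem_supp_iff, S.connectedComponentMk_eq_iff, hr]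
      let e : Fin k ≃ (S.graph.connectedComponentMk v).supp :=
        Equiv.ofBijective (fun i => ⟨f i, (hm _).mpr ⟨i, rfl⟩⟩)
          ⟨fun i j hij => hf (congrArg Subtype.val hij), fun ⟨u, hu⟩ =>
            let ⟨i, hi⟩ := (hm u).mp hu
            ⟨i, Subtype.ext hi⟩⟩
      exact ⟨(RelIso.mk e (fun {i j} => ha i j)).symm⟩
    have hc := S.root_notMem v
    rcases S.leaves_cases hc with ⟨x, hx, hxc, hr⟩ | ⟨x, hx, y, hy, hne, hxc, hyc, hr⟩
    · have h1 : x ≠ S.root v := fun h => hc (h ▸ hx)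
      refine ⟨2, le_rfl, hiso 2 ![x, S.root v] ?_ ?_ ?_⟩
      · intro i j
        fin_cases i <;> fin_cases j <;> simp [h1, h1.symm]
      · intro u
        simp [hr]
        tauto
      · intro i j
        fin_cases i <;> fin_cases j <;> simp [graph, pathGraph_adj, hx, hc, hxc]
    · have h1 : x ≠ S.root v := fun h => hc (h ▸ hx)
      have h2 : y ≠ S.root v := fun h => hc (h ▸ hy)
      refine ⟨3, by omega, hiso 3 ![x, S.root v, y] ?_ ?_ ?_⟩
      · intro i j
        fin_cases i <;> fin_cases j <;> simp [h1, h1.symm, h2, h2.symm, hne, hne.symm]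
      · intro u
        simp [hr]
        tauto
      · intro i j
        fin_cases i <;> fin_cases j <;>
          simp [graph, pathGraph_adj, hx, hy, hc, hxc, hyc, h1.symm, h2.symm]

end ShortStarFactor

end SimpleGraph

namespace SimpleGraph

namespace ShortStarFactor

variable {R V : Type*} {P : SimpleGraph R} {H : SimpleGraph V} (S : H.ShortStarFactor)

/-- A Hamiltonian cycle in two adjacent copies of a star, containing all the edges of the star in
both copies and all the edges between the copies of a leaf. -/
theorem exists_isCycle_two_rows {a b : R} (hab : P.Adj a b) {c : V} (hc : c ∉ S.leaves) :
    ∃ (x : R × V) (p : (P.boxProd H).Walk x x), p.IsCycle ∧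
      (∀ q, q ∈ p.support ↔ (q.1 = a ∨ q.1 = b) ∧ S.root q.2 = c) ∧
      ∀ l ∈ S.leaves, S.center l = c → s((a, l), (b, l)) ∈ p.edges ∧
        s((a, c), (a, l)) ∈ p.edges ∧ s((b, c), (b, l)) ∈ p.edges := by
  have hne := hab.ne
  have hver : ∀ v, (P.boxProd H).Adj (a, v) (b, v) := fun v => boxProd_adj_left.mpr hab
  have hhor : ∀ (i : R) l, S.center l = c → (P.boxProd H).Adj (i, l) (i, c) := fun i l h =>
    boxProd_adj_right.mpr (h ▸ S.adj_center l)
  rcases S.leaves_cases hc with ⟨x, hx, hxc, hr⟩ | ⟨x, hx, y, hy, hxy, hxc, hyc, hr⟩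
  · have hxc' : x ≠ c := fun h => hc (h ▸ hx)
    refine ⟨(a, x), .cons (hhor a x hxc) (.cons (hver c) (.cons (hhor b x hxc).symm
      (.cons (hver x).symm .nil))), ?_, ?_, ?_⟩
    · simp [Walk.cons_isCycle_iff, Walk.isPath_def, hne, hne.symm, hxc', hxc'.symm]
    · rintro ⟨i, v⟩
      simp only [Walk.support_cons, Walk.support_nil, List.mem_cons, Prod.mk.injEq,
        List.not_mem_nil, or_false, hr]
      tauto
    · intro l hl hlc
      have : l = x := by
        have h := (hr l).mp ((S.root_eq_iff hc).mpr (Or.inr ⟨hl, hlc⟩))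
        rcases h with h | rfl
        exacts [h, (hc hl).elim]
      subst this
      simp
  · have hxc' : x ≠ c := fun h => hc (h ▸ hx)
    have hyc' : y ≠ c := fun h => hc (h ▸ hy)
    refine ⟨(a, x), .cons (hhor a x hxc) (.cons (hhor a y hyc).symm (.cons (hver y)
      (.cons (hhor b y hyc) (.cons (hhor b x hxc).symm (.cons (hver x).symm .nil))))), ?_, ?_, ?_⟩
    · simp [Walk.cons_isCycle_iff, Walk.isPath_def, hne, hne.symm, hxc', hxc'.symm, hyc',
        hyc'.symm, hxy, hxy.symm]
    · rintro ⟨i, v⟩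
      simp only [Walk.support_cons, Walk.support_nil, List.mem_cons, Prod.mk.injEq,
        List.not_mem_nil, or_false, hr]
      tauto
    · intro l hl hlc
      have h := (hr l).mp ((S.root_eq_iff hc).mpr (Or.inr ⟨hl, hlc⟩))
      rcases h with rfl | rfl | rfl
      · simp
      · exact (hc hl).elim
      · simp

/-- The gaps `i`, between rows `i` and `i + 1`, that the cycle through the copies of the star of `v`
is required to cross in the column of `v`. -/
def Crosses (v : V) (i : ℕ) : Prop :=
  (v ∉ S.leaves ∧ i % 2 = 1) ∨
    (v ∈ S.leaves ∧ (i % 2 = 0 ∨ (S.label v = true ∧ i % 4 = 1) ∨ (S.label v = false ∧ i % 4 = 3)))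

/-- At each odd gap some leaf is available for passing to the next pair of rows. -/
theorem exists_leaf_of_gap {c : V} (hc : c ∉ S.leaves) (m : ℕ) :
    ∃ x ∈ S.leaves, S.center x = c ∧ ∀ l ∈ S.leaves, S.center l = c →
      S.Crosses l (2 * m + 1) → l = x := by
  have hlab : ∀ l ∈ S.leaves, S.Crosses l (2 * m + 1) → S.label l = decide (m % 2 = 0) := by
    intro l hl h
    rcases h with h | ⟨-, h | h | h⟩
    · exact (h.1 hl).elim
    · omega
    · rw [h.1]; symm; rw [decide_eq_true_eq]; omega
    · rw [h.1]; symm; rw [decide_eq_false_iff_not]; omega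
  by_cases h : ∃ x ∈ S.leaves, S.center x = c ∧ S.Crosses x (2 * m + 1)
  · obtain ⟨x, hx, hxc, hcr⟩ := h
    exact ⟨x, hx, hxc, fun l hl hlc hlcr => S.label_injective l x (hlc.trans hxc.symm)
      ((hlab l hl hlcr).trans (hlab x hx hcr).symm)⟩
  · push Not at h
    obtain ⟨x, hx, hxc⟩ := S.exists_leaf c hc
    exact ⟨x, hx, hxc, fun l hl hlc hlcr => (h l hl hlc hlcr).elim⟩

variable {n : ℕ} {r : ℕ → R}

theorem exists_isCycle_rows (hr : ∀ i, i + 1 < n → P.Adj (r i) (r (i + 1)))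
    (hinj : ∀ i < n, ∀ j < n, r i = r j → i = j) {c : V} (hc : c ∉ S.leaves) (m : ℕ)
    (hm : 2 * (m + 1) ≤ n) :
    ∃ (x : R × V) (p : (P.boxProd H).Walk x x), p.IsCycle ∧
      (∀ q, q ∈ p.support ↔ (∃ i < 2 * (m + 1), q.1 = r i) ∧ S.root q.2 = c) ∧
      (∀ v, S.root v = c → ∀ i, i + 1 < 2 * (m + 1) → S.Crosses v i →
        s((r i, v), (r (i + 1), v)) ∈ p.edges) ∧
      ∀ l ∈ S.leaves, S.center l = c → s((r (2 * m + 1), c), (r (2 * m + 1), l)) ∈ p.edges := by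
  induction m with
  | zero =>
    obtain ⟨x, p, hp, hs, he⟩ := S.exists_isCycle_two_rows (hr 0 (by omega)) hc
    refine ⟨x, p, hp, ?_, ?_, fun l hl hlc => (he l hl hlc).2.2⟩
    · intro q
      rw [hs]
      refine and_congr_left fun _ => ⟨?_, ?_⟩
      · rintro (h | h)
        exacts [⟨0, by omega, h⟩, ⟨1, by omega, h⟩]
      · rintro ⟨i, hi, h⟩
        have : i = 0 ∨ i = 1 := by omega
        rcases this with rfl | rfl
        exacts [Or.inl h, Or.inr h]
    · intro v hv i hi hcr
      obtain rfl : i = 0 := by omega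
      rcases hcr with ⟨-, h⟩ | ⟨h, -⟩
      · omega
      · exact (he v h ((S.root_of_mem h).symm.trans hv)).1
  | succ m ih =>
    obtain ⟨x, p, hp, hs, he, hlast⟩ := ih (by omega)
    obtain ⟨x', p', hp', hs', he'⟩ := S.exists_isCycle_two_rows (hr (2 * m + 2) (by omega)) hc
    obtain ⟨l, hl, hlc, huniq⟩ := S.exists_leaf_of_gap hc m
    have hup := hr (2 * m + 1) (by omega)
    obtain ⟨y, q, hq, hqs, hqe, hqe', hqc, hql⟩ := hp.exists_merge hp' (by
      intro w hw hw'
      rw [hs] at hw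
      rw [hs'] at hw'
      obtain ⟨⟨i, hi, h⟩, -⟩ := hw
      rcases hw'.1 with h' | h' <;>
        · have := hinj i (by omega) _ (by omega) (h.symm.trans h')
          omega) (hlast l hl hlc) (he' l hl hlc).2.1 (boxProd_adj_left.mpr hup)
      (boxProd_adj_left.mpr hup)
    refine ⟨y, q, hq, ?_, ?_, ?_⟩
    · intro w
      rw [hqs, hs, hs', ← or_and_right]
      refine and_congr_left fun _ => ⟨?_, ?_⟩
      · rintro (⟨i, hi, h⟩ | h | h)
        exacts [⟨i, by omega, h⟩, ⟨_, by omega, h⟩, ⟨_, by omega, h⟩]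
      · rintro ⟨i, hi, h⟩
        by_cases h1 : i < 2 * (m + 1)
        · exact Or.inl ⟨i, h1, h⟩
        · have : i = 2 * m + 2 ∨ i = 2 * m + 2 + 1 := by omega
          rcases this with rfl | rfl
          exacts [Or.inr (Or.inl h), Or.inr (Or.inr h)]
    · intro v hv i hi hcr
      have hii : r i ≠ r (i + 1) := (hr i (by omega)).ne
      have hvert : ∀ k w w', s((r i, v), (r (i + 1), v)) ≠ s((r k, w), (r k, w')) := by
        intro k w w' h
        simp only [Sym2.eq_iff, Prod.mk.injEq] at h
        rcases h with h | h <;> exact hii (h.1.1.trans h.2.1.symm)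
      rcases lt_trichotomy i (2 * m + 1) with h | rfl | h
      · exact hqe _ (he v hv i (by omega) hcr) (hvert _ _ _)
      · by_cases hvl : v ∈ S.leaves
        · rw [huniq v hvl ((S.root_of_mem hvl).symm.trans hv) hcr]
          exact hql
        · rw [S.root_of_notMem hvl] at hv
          rw [hv]
          exact hqc
      · obtain rfl : i = 2 * m + 2 := by omega
        rcases hcr with ⟨-, h⟩ | ⟨h, -⟩
        · omega
        · exact hqe' _ (he' v h ((S.root_of_mem h).symm.trans hv)).1 (hvert _ _ _)
    · intro l' hl' hlc'
      refine hqe' _ (he' l' hl' hlc').2.2 fun h => ?_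
      simp only [Sym2.eq_iff, Prod.mk.injEq] at h
      rcases h with h | h <;> exact (hr (2 * m + 2) (by omega)).ne h.1.1.symm

end ShortStarFactor

end SimpleGraph

namespace SimpleGraph

variable {V : Type*} [Fintype V] [DecidableEq V] {H : SimpleGraph V} [DecidableRel H.Adj]

theorem IsTough.card_le_two_mul_card_biUnion_neighborFinset {n : ℕ} (heven : Even n)
    (hord : 3 ≤ n * Fintype.card V) (ht : ((pathGraph n).boxProd H).IsTough 1) {A : Set V}
    (hA : ∀ u v, H.Adj u v → (u ∈ A ↔ v ∉ A)) {I : Finset V} (hI : ∀ v ∈ I, v ∈ A) :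
    I.card ≤ 2 * (I.biUnion fun v => H.neighborFinset v).card := by
  classical
  have hn : 2 ≤ n := by
    rcases heven with ⟨m, rfl⟩
    have : m ≠ 0 := by rintro rfl; simp at hord
    omega
  set N := I.biUnion (fun v => H.neighborFinset v) with hN
  have hmemN : ∀ v, v ∈ N ↔ ∃ u ∈ I, H.Adj u v := by simp [hN]
  have hNA : ∀ v ∈ N, v ∉ A := by
    intro v hv
    obtain ⟨u, hu, huv⟩ := (hmemN v).mp hv
    exact (hA u v huv).mp (hI u hu)
  let z : Fin n := ⟨0, by omega⟩
  let K : Finset (Fin n × V) := Finset.univ.filter fun p => (Odd p.1.val ↔ p.2 ∈ A)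
  have hK : ∀ p, p ∈ K ↔ (Odd p.1.val ↔ p.2 ∈ A) := by simp [K]
  have hKc : K.card = Kᶜ.card := by
    have hrev : ∀ i : Fin n, Odd i.rev.val ↔ ¬ Odd i.val := by
      intro i
      rw [Fin.val_rev]
      obtain ⟨m, rfl⟩ := heven
      simp only [Nat.odd_iff]
      omega
    refine Finset.card_nbij' (fun p => (p.1.rev, p.2)) (fun p => (p.1.rev, p.2)) ?_ ?_ ?_ ?_
    · intro p hp
      simp only [Finset.mem_coe, Finset.mem_compl, hK, hrev] at hp ⊢
      tauto
    · intro p hp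
      simp only [Finset.mem_coe, Finset.mem_compl, hK, hrev] at hp ⊢
      tauto
    · intro p _
      simp
    · intro p _
      simp
  have hKcard : K.card + Kᶜ.card = n * Fintype.card V := by
    rw [Finset.card_add_card_compl]
    simp
  have hcardz : ∀ T : Finset V, (({z} : Finset (Fin n)) ×ˢ T).card = T.card := by
    intro T
    simp
  set S : Finset (Fin n × V) := (Kᶜ \ ({z} ×ˢ I)) ∪ ({z} ×ˢ N) with hS
  have hScard : S.card ≤ Kᶜ.card - I.card + N.card := by
    refine (Finset.card_union_le _ _).trans ?_
    rw [Finset.card_sdiff_of_subset, hcardz, hcardz]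
    intro p hp
    simp only [Finset.mem_product, Finset.mem_singleton] at hp
    rw [Finset.mem_compl, hK, hp.1]
    simp [z, hI _ hp.2]
  have hIK : I.card ≤ Kᶜ.card := by
    rw [← hcardz I]
    apply Finset.card_le_card
    intro p hp
    simp only [Finset.mem_product, Finset.mem_singleton] at hp
    rw [Finset.mem_compl, hK, hp.1]
    simp [z, hI _ hp.2]
  have hmemS : ∀ p, p ∉ S ↔ ((p ∈ K ∧ ¬ (p.1 = z ∧ p.2 ∈ N)) ∨ (p.1 = z ∧ p.2 ∈ I)) := by
    intro p
    have : p.2 ∈ I → p.2 ∉ N := fun h h' => hNA _ h' (hI _ h)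
    simp only [hS, Finset.mem_union, Finset.mem_sdiff, Finset.mem_compl, Finset.mem_product,
      Finset.mem_singleton]
    tauto
  let o : Fin n := ⟨1, by omega⟩
  let φ : Fin n × V → Fin n × V := fun p => if p.1 = z ∧ p.2 ∈ I then (o, p.2) else p
  have hφ : ∀ p q, p ∉ S → q ∉ S → ((pathGraph n).boxProd H).Adj p q → φ p = φ q := by
    have base : ∀ p q, p.1 = z → p.2 ∈ I → q ∉ S → ((pathGraph n).boxProd H).Adj p q →
        φ p = φ q := by
      rintro ⟨i, v⟩ ⟨j, w⟩ hi hv hq hadj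
      simp only at hi hv
      subst hi
      rw [boxProd_adj] at hadj
      rcases hadj with ⟨h1, h2⟩ | ⟨h1, h2⟩
      · simp only [pathGraph_adj] at h1 h2
        subst h2
        have hj : j = o := by
          ext
          simp only [z, o] at h1 ⊢
          omega
        subst hj
        simp [φ, hv]
      · simp only at h1 h2
        subst h2
        rcases (hmemS _).mp hq with h | h
        · exact (h.2 ⟨rfl, (hmemN w).mpr ⟨v, hv, h1⟩⟩).elim
        · exact ((hA _ _ h1).mp (hI _ hv) (hI _ h.2)).elim
    intro p q hp hq hadj
    rcases (hmemS p).mp hp with hp' | hp'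
    · rcases (hmemS q).mp hq with hq' | hq'
      · exfalso
        have h1 := (hK p).mp hp'.1
        have h2 := (hK q).mp hq'.1
        rw [boxProd_adj] at hadj
        rcases hadj with ⟨h3, h4⟩ | ⟨h3, h4⟩
        · rw [h4, ← h2] at h1
          rw [pathGraph_adj] at h3
          simp only [Nat.odd_iff] at h1
          omega
        · have := hA _ _ h3
          rw [h4] at h1
          tauto
      · exact (base q p hq'.1 hq'.2 hp hadj.symm).symm
    · exact base p q hp'.1 hp'.2 hq hadj
  have hcomp : K.card - N.card ≤ ((pathGraph n).boxProd H).numComponentsCompl S := by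
    refine (Finset.le_card_sdiff (({z} : Finset (Fin n)) ×ˢ N) K |>.trans' ?_).trans ?_
    · rw [hcardz]
    · have hns : ∀ p : (K \ (({z} : Finset (Fin n)) ×ˢ N) : Finset _), p.1 ∉ S := by
        rintro ⟨p, hp⟩
        rw [hmemS]
        simp only [Finset.mem_sdiff, Finset.mem_product, Finset.mem_singleton] at hp
        exact Or.inl hp
      let f : (K \ (({z} : Finset (Fin n)) ×ˢ N) : Finset _) →
          (((pathGraph n).boxProd H).induce ((S : Set (Fin n × V))ᶜ)).ConnectedComponent :=
        fun p => connectedComponentMk _ ⟨p.1, by simpa using hns p⟩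
      have hf : Function.Injective f := by
        rintro p q hpq
        have hwalk : ∀ (x y : ((S : Set (Fin n × V))ᶜ : Set _)),
            (((pathGraph n).boxProd H).induce ((S : Set (Fin n × V))ᶜ)).Reachable x y →
            φ x = φ y := by
          rintro x y ⟨w⟩
          induction w with
          | nil => rfl
          | @cons a b c h _ ih =>
            rw [← ih]
            exact hφ _ _ (fun h => a.2 h) (fun h => b.2 h) h
        have h1 := hwalk _ _ (ConnectedComponent.exact hpq)
        have hid : ∀ p : (K \ (({z} : Finset (Fin n)) ×ˢ N) : Finset _), φ p.1 = p.1 := by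
          rintro ⟨p, hp⟩
          have hpK := (hK p).mp (Finset.mem_sdiff.mp hp).1
          refine if_neg ?_
          rintro ⟨h1, h2⟩
          rw [h1] at hpK
          simp [z, hI _ h2] at hpK
        simp only [hid] at h1
        exact Subtype.ext h1
      have := Nat.card_le_card_of_injective f hf
      rwa [Nat.card_eq_finsetCard] at this
  have hINcard : I.card + N.card ≤ Fintype.card V := by
    rw [← Finset.card_union_of_disjoint]
    · exact Finset.card_le_univ _
    · rw [Finset.disjoint_left]
      exact fun v h h' => hNA _ h' (hI _ h)
  have hVK : 2 * Fintype.card V ≤ n * Fintype.card V := Nat.mul_le_mul_right _ hn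
  by_contra! hlt
  have h2 : 2 ≤ ((pathGraph n).boxProd H).numComponentsCompl S := by omega
  have h3 := ht S h2
  rw [one_mul] at h3
  have h4 : ((pathGraph n).boxProd H).numComponentsCompl S ≤ S.card := by exact_mod_cast h3
  omega

theorem IsTough.exists_injective {n : ℕ} (heven : Even n) (hord : 3 ≤ n * Fintype.card V)
    (ht : ((pathGraph n).boxProd H).IsTough 1) (hb : H.IsBipartite) :
    ∃ f : V → V × Bool, Function.Injective f ∧ ∀ v, H.Adj v (f v).1 := by
  classical
  obtain ⟨A, hA⟩ := hb.exists_adj_imp_mem_iff_notMem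
  have hA' : ∀ u v, H.Adj u v → (u ∈ Aᶜ ↔ v ∉ Aᶜ) := by
    intro u v h
    have := hA u v h
    simp only [Set.mem_compl_iff]
    tauto
  have hall := (Finset.all_card_le_biUnion_card_iff_exists_injective
    (fun v => H.neighborFinset v ×ˢ (Finset.univ : Finset Bool))).mp ?_
  · obtain ⟨f, hf, hf'⟩ := hall
    exact ⟨f, hf, fun v => by simpa using hf' v⟩
  · intro I
    have hprod : I.biUnion (fun v => H.neighborFinset v ×ˢ (Finset.univ : Finset Bool)) =
        (I.biUnion fun v => H.neighborFinset v) ×ˢ (Finset.univ : Finset Bool) := by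
      ext
      simp
    rw [hprod, Finset.card_product, Finset.card_univ, Fintype.card_bool]
    have h1 := ht.card_le_two_mul_card_biUnion_neighborFinset heven hord hA
      (I := I.filter (· ∈ A)) (by simp)
    have h2 := ht.card_le_two_mul_card_biUnion_neighborFinset heven hord hA'
      (I := I.filter (· ∉ A)) (by simp)
    have h3 := Finset.card_filter_add_card_filter_not (s := I) (· ∈ A)
    have h4 : ((I.filter (· ∈ A)).biUnion fun v => H.neighborFinset v).card +
        ((I.filter (· ∉ A)).biUnion fun v => H.neighborFinset v).card ≤
        (I.biUnion fun v => H.neighborFinset v).card := by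
      rw [← Finset.card_union_of_disjoint]
      · apply Finset.card_le_card
        apply Finset.union_subset <;> apply Finset.biUnion_subset_biUnion_of_subset_left <;>
          exact Finset.filter_subset _ _
      · rw [Finset.disjoint_left]
        intro v hv hv'
        simp only [Finset.mem_biUnion, Finset.mem_filter, mem_neighborFinset] at hv hv'
        obtain ⟨u, ⟨-, hu⟩, huv⟩ := hv
        obtain ⟨w, ⟨-, hw⟩, hwv⟩ := hv'
        exact hw ((hA _ _ hwv).mpr ((hA _ _ huv).mp hu))
    omega

end SimpleGraph

namespace SimpleGraph

namespace ShortStarFactor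

section

variable {R V : Type*} {P : SimpleGraph R} {H : SimpleGraph V} (S : H.ShortStarFactor)
variable {n : ℕ} {r : ℕ → R}

theorem exists_isCycle_star (heven : Even n) (hn : n ≠ 0)
    (hr : ∀ i, i + 1 < n → P.Adj (r i) (r (i + 1)))
    (hinj : ∀ i < n, ∀ j < n, r i = r j → i = j) {c : V} (hc : c ∉ S.leaves) :
    ∃ (x : R × V) (p : (P.boxProd H).Walk x x), p.IsCycle ∧
      (∀ q, q ∈ p.support ↔ (∃ i < n, q.1 = r i) ∧ S.root q.2 = c) ∧
      ∀ v, S.root v = c → ∀ i, i + 1 < n → S.Crosses v i →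
        s((r i, v), (r (i + 1), v)) ∈ p.edges := by
  obtain ⟨k, rfl⟩ := heven
  obtain ⟨m, rfl⟩ : ∃ m, k = m + 1 := ⟨k - 1, by omega⟩
  have hk : m + 1 + (m + 1) = 2 * (m + 1) := by omega
  rw [hk] at hr hinj ⊢
  obtain ⟨x, p, hp, hs, he, -⟩ := S.exists_isCycle_rows hr hinj hc m le_rfl
  exact ⟨x, p, hp, hs, he⟩

theorem exists_common_residue (v w : V) :
    ∃ ρ < 4, ∀ k, S.Crosses v (4 * k + ρ) ∧ S.Crosses w (4 * k + ρ) := by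
  have hcen : ∀ u, u ∉ S.leaves → ∀ k ρ, ρ % 2 = 1 → S.Crosses u (4 * k + ρ) :=
    fun u hu k ρ hρ => Or.inl ⟨hu, by omega⟩
  have hleaf : ∀ u, u ∈ S.leaves → ∃ ρ < 4, ρ % 2 = 1 ∧ ∀ k, S.Crosses u (4 * k + ρ) := by
    intro u hu
    cases h : S.label u
    · exact ⟨3, by omega, rfl, fun k => Or.inr ⟨hu, Or.inr (Or.inr ⟨h, by omega⟩)⟩⟩
    · exact ⟨1, by omega, rfl, fun k => Or.inr ⟨hu, Or.inr (Or.inl ⟨h, by omega⟩)⟩⟩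
  by_cases hv : v ∈ S.leaves <;> by_cases hw : w ∈ S.leaves
  · exact ⟨0, by omega, fun k => ⟨Or.inr ⟨hv, Or.inl (by omega)⟩, Or.inr ⟨hw, Or.inl (by omega)⟩⟩⟩
  · obtain ⟨ρ, h1, h2, h3⟩ := hleaf v hv
    exact ⟨ρ, h1, fun k => ⟨h3 k, hcen w hw k ρ h2⟩⟩
  · obtain ⟨ρ, h1, h2, h3⟩ := hleaf w hw
    exact ⟨ρ, h1, fun k => ⟨hcen v hv k ρ h2, h3 k⟩⟩
  · exact ⟨1, by omega, fun k => ⟨hcen v hv k 1 rfl, hcen w hw k 1 rfl⟩⟩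

theorem exists_adj_root_eq (v : V) : ∃ u, H.Adj v u ∧ S.root u = S.root v := by
  by_cases hv : v ∈ S.leaves
  · exact ⟨S.center v, S.adj_center v, S.root_eq_of_adj (Or.inr ⟨hv, rfl⟩)⟩
  · obtain ⟨u, hu, rfl⟩ := S.exists_leaf v hv
    exact ⟨u, (S.adj_center u).symm, S.root_eq_of_adj (Or.inl ⟨hu, rfl⟩)⟩

open Classical in
/-- The gaps of the column of `v` which the walk `p` should cross but does not. -/
noncomputable def missedGaps (n : ℕ) (r : ℕ → R) {x : R × V} (p : (P.boxProd H).Walk x x)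
    (v : V) : Finset ℕ :=
  (Finset.range (n - 1)).filter fun i => S.Crosses v i ∧ s((r i, v), (r (i + 1), v)) ∉ p.edges

open Classical in
/-- The neighbours of `v` in `W` lying in other stars. -/
noncomputable def outerNeighbors [Fintype V] (W : Set V) (v : V) : Finset V :=
  Finset.univ.filter fun u => u ∈ W ∧ H.Adj v u ∧ S.root u ≠ S.root v

theorem mem_missedGaps {x : R × V} {p : (P.boxProd H).Walk x x} {v : V} {i : ℕ} :
    i ∈ S.missedGaps n r p v ↔
      i + 1 < n ∧ S.Crosses v i ∧ s((r i, v), (r (i + 1), v)) ∉ p.edges := by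
  simp [missedGaps, Nat.lt_sub_iff_add_lt]

theorem mem_outerNeighbors [Fintype V] {W : Set V} {v u : V} :
    u ∈ S.outerNeighbors W v ↔ u ∈ W ∧ H.Adj v u ∧ S.root u ≠ S.root v := by
  simp [outerNeighbors]

/-- There is a cycle through the copies of the vertices of `W`, a union of stars, missing at most as
many gaps in each column as required for attaching the other stars within `W`. -/
def HasCycleOn [Fintype V] (P : SimpleGraph R) (n : ℕ) (r : ℕ → R) (W : Set V) : Prop :=
  (∀ u v, S.root u = S.root v → u ∈ W → v ∈ W) ∧
    ∃ (x : R × V) (p : (P.boxProd H).Walk x x), p.IsCycle ∧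
      (∀ q, q ∈ p.support ↔ (∃ i < n, q.1 = r i) ∧ q.2 ∈ W) ∧
      ∀ v ∈ W, (S.missedGaps n r p v).card ≤ (S.outerNeighbors W v).card

theorem hasCycleOn_star [Fintype V] (heven : Even n) (hn : n ≠ 0)
    (hr : ∀ i, i + 1 < n → P.Adj (r i) (r (i + 1)))
    (hinj : ∀ i < n, ∀ j < n, r i = r j → i = j) {c : V} (hc : c ∉ S.leaves) :
    S.HasCycleOn P n r {v | S.root v = c} := by
  obtain ⟨x, p, hp, hs, he⟩ := S.exists_isCycle_star heven hn hr hinj hc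
  refine ⟨fun u v h hu => h.symm.trans hu, x, p, hp, hs, fun v hv => ?_⟩
  rw [Finset.card_eq_zero.mpr]
  · exact Nat.zero_le _
  · rw [Finset.eq_empty_iff_forall_notMem]
    intro i hi
    obtain ⟨h1, h2, h3⟩ := S.mem_missedGaps.mp hi
    exact h3 (he v hv i h1 h2)

theorem HasCycleOn.extend [Fintype V] [DecidableRel H.Adj] {S : H.ShortStarFactor} {W : Set V}
    (hW : S.HasCycleOn P n r W)
    (heven : Even n) (hn : n ≠ 0) (hdeg : 4 * H.maxDegree ≤ n + 2)
    (hr : ∀ i, i + 1 < n → P.Adj (r i) (r (i + 1)))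
    (hinj : ∀ i < n, ∀ j < n, r i = r j → i = j) {v w : V} (hv : v ∈ W) (hw : w ∉ W)
    (hvw : H.Adj v w) : S.HasCycleOn P n r (W ∪ {u | S.root u = S.root w}) := by
  classical
  obtain ⟨hsat, x, p, hp, hs, hm⟩ := hW
  obtain ⟨x', p', hp', hs', he'⟩ :=
    S.exists_isCycle_star heven hn hr hinj (S.root_notMem w)
  have hroot : S.root w ≠ S.root v := fun h => hw (hsat v w h.symm hv)
  have hfew : (S.outerNeighbors W v).card + 2 ≤ H.maxDegree := by
    obtain ⟨u, hu, hur⟩ := S.exists_adj_root_eq v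
    refine le_trans ?_ (H.degree_le_maxDegree v)
    have huw : u ≠ w := fun h => hroot (h ▸ hur)
    have h1 : u ∉ S.outerNeighbors W v := fun h => (S.mem_outerNeighbors.mp h).2.2 hur
    have h2 : w ∉ insert u (S.outerNeighbors W v) := by
      rw [Finset.mem_insert, not_or]
      exact ⟨huw.symm, fun h => hw (S.mem_outerNeighbors.mp h).1⟩
    rw [← card_neighborFinset_eq_degree, show (S.outerNeighbors W v).card + 2 =
      (insert w (insert u (S.outerNeighbors W v))).card by
        rw [Finset.card_insert_of_notMem h2, Finset.card_insert_of_notMem h1]]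
    apply Finset.card_le_card
    intro y hy
    rw [mem_neighborFinset]
    simp only [Finset.mem_insert, S.mem_outerNeighbors] at hy
    rcases hy with rfl | rfl | h
    exacts [hvw, hu, h.2.1]
  obtain ⟨ρ, hρ, hres⟩ := S.exists_common_residue v w
  obtain ⟨i, hi, hcv, hcw, hip⟩ : ∃ i, i + 1 < n ∧ S.Crosses v i ∧ S.Crosses w i ∧
      s((r i, v), (r (i + 1), v)) ∈ p.edges := by
    by_contra! hcon
    have hsub : (Finset.range (H.maxDegree - 1)).image (fun k => 4 * k + ρ) ⊆
        S.missedGaps n r p v := by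
      intro i hi
      obtain ⟨k, hk, rfl⟩ := Finset.mem_image.mp hi
      rw [Finset.mem_range] at hk
      have hlt : 4 * k + ρ + 1 < n := by omega
      exact S.mem_missedGaps.mpr
        ⟨hlt, (hres k).1, hcon _ hlt (hres k).1 (hres k).2⟩
    have h1 := Finset.card_le_card hsub
    rw [Finset.card_image_of_injective _ (fun a b h => by simpa using h), Finset.card_range] at h1
    have h2 := hm v hv
    omega
  have hdisj : ∀ q ∈ p.support, q ∉ p'.support := fun q hq hq' =>
    hw (hsat _ _ ((hs' q).mp hq').2 ((hs q).mp hq).2)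
  obtain ⟨y, q, hq, hqs, hqe, hqe', -, -⟩ := hp.exists_merge hp' hdisj hip (he' w rfl i hi hcw)
    (boxProd_adj_right.mpr hvw) (boxProd_adj_right.mpr hvw)
  have hgap : ∀ {u u' : V} {j : ℕ}, j + 1 < n →
      s((r j, u), (r (j + 1), u)) = s((r i, u'), (r (i + 1), u')) → j = i ∧ u = u' := by
    intro u u' j hj h
    simp only [Sym2.eq_iff, Prod.mk.injEq] at h
    rcases h with ⟨⟨h1, h2⟩, -⟩ | ⟨⟨h1, h2⟩, h3, -⟩
    · exact ⟨hinj _ (by omega) _ (by omega) h1, h2⟩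
    · have := hinj _ (by omega) _ (by omega) h1
      have := hinj _ (by omega) _ (by omega) h3
      omega
  have hmono : ∀ u, S.outerNeighbors W u ⊆ S.outerNeighbors (W ∪ {u | S.root u = S.root w}) u := by
    intro u z hz
    rw [S.mem_outerNeighbors] at hz ⊢
    exact ⟨Or.inl hz.1, hz.2⟩
  refine ⟨?_, y, q, hq, ?_, ?_⟩
  · rintro a b hab (h | h)
    exacts [Or.inl (hsat a b hab h), Or.inr (hab.symm.trans h)]
  · intro z
    rw [hqs, hs, hs', ← and_or_left]
    rfl
  · have hmW : ∀ u ∈ W, ∀ j ∈ S.missedGaps n r q u, j ∈ S.missedGaps n r p u ∨ (j = i ∧ u = v) := by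
      intro u _ j hj
      obtain ⟨h1, h2, h3⟩ := S.mem_missedGaps.mp hj
      by_cases hju : j = i ∧ u = v
      · exact Or.inr hju
      · refine Or.inl (S.mem_missedGaps.mpr ⟨h1, h2, fun h => h3 (hqe _ h fun h' => ?_)⟩)
        exact hju (hgap h1 h')
    have hmD : ∀ u, S.root u = S.root w → ∀ j ∈ S.missedGaps n r q u, j = i ∧ u = w := by
      intro u hu j hj
      obtain ⟨h1, h2, h3⟩ := S.mem_missedGaps.mp hj
      by_contra hju
      exact h3 (hqe' _ (he' u hu j h1 h2) fun h' => hju (hgap h1 h'))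
    rintro u (hu | hu)
    · by_cases huv : u = v
      · subst huv
        have hwn : w ∉ S.outerNeighbors W u := fun h => hw (S.mem_outerNeighbors.mp h).1
        calc (S.missedGaps n r q u).card ≤ (insert i (S.missedGaps n r p u)).card := by
              apply Finset.card_le_card
              intro j hj
              rw [Finset.mem_insert]
              rcases hmW u hu j hj with h | h
              exacts [Or.inr h, Or.inl h.1]
          _ ≤ (S.missedGaps n r p u).card + 1 := Finset.card_insert_le _ _
          _ ≤ (S.outerNeighbors W u).card + 1 := Nat.succ_le_succ (hm u hu)
          _ = (insert w (S.outerNeighbors W u)).card := (Finset.card_insert_of_notMem hwn).symm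
          _ ≤ _ := by
              apply Finset.card_le_card
              apply Finset.insert_subset _ (hmono u)
              exact S.mem_outerNeighbors.mpr ⟨Or.inr rfl, hvw, hroot⟩
      · calc (S.missedGaps n r q u).card ≤ (S.missedGaps n r p u).card := by
              apply Finset.card_le_card
              intro j hj
              rcases hmW u hu j hj with h | h
              exacts [h, (huv h.2).elim]
          _ ≤ (S.outerNeighbors W u).card := hm u hu
          _ ≤ _ := Finset.card_le_card (hmono u)
    · by_cases huw : u = w
      · subst huw
        calc (S.missedGaps n r q u).card ≤ ({i} : Finset ℕ).card := by
              apply Finset.card_le_card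
              intro j hj
              exact Finset.mem_singleton.mpr (hmD u hu j hj).1
          _ = ({v} : Finset V).card := rfl
          _ ≤ _ := by
              apply Finset.card_le_card
              rw [Finset.singleton_subset_iff]
              exact S.mem_outerNeighbors.mpr ⟨Or.inl hv, hvw.symm, hroot.symm⟩
      · rw [Finset.card_eq_zero.mpr]
        · exact Nat.zero_le _
        · rw [Finset.eq_empty_iff_forall_notMem]
          exact fun j hj => huw (hmD u hu j hj).2

theorem hasCycleOn_univ [Fintype V] [DecidableRel H.Adj] (hconn : H.Connected) (heven : Even n) (hn : n ≠ 0)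
    (hdeg : 4 * H.maxDegree ≤ n + 2) (hr : ∀ i, i + 1 < n → P.Adj (r i) (r (i + 1)))
    (hinj : ∀ i < n, ∀ j < n, r i = r j → i = j) : S.HasCycleOn P n r Set.univ := by
  obtain ⟨v₀⟩ := hconn.nonempty
  have hstart := S.hasCycleOn_star heven hn hr hinj (S.root_notMem v₀)
  obtain ⟨W, ⟨hW, hne⟩, hmax⟩ :=
    (Set.toFinite {W : Set V | S.HasCycleOn P n r W ∧ v₀ ∈ W}).exists_maximal ⟨_, hstart, rfl⟩
  by_cases huniv : W = Set.univ
  · exact huniv ▸ hW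
  · obtain ⟨w₀, hw₀⟩ := (Set.ne_univ_iff_exists_notMem W).mp huniv
    obtain ⟨p⟩ := hconn.preconnected v₀ w₀
    obtain ⟨d, -, hd, hd'⟩ := p.exists_boundary_dart W hne hw₀
    have := hmax ⟨hW.extend heven hn hdeg hr hinj hd hd' d.adj, Or.inl hne⟩ Set.subset_union_left
    exact (hd' (this (Or.inr rfl))).elim

end

theorem isHamiltonian_pathGraph_boxProd {V : Type*} [Fintype V] [DecidableEq V]
    {H : SimpleGraph V} [DecidableRel H.Adj] (S : H.ShortStarFactor) (hconn : H.Connected) {n : ℕ}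
    (heven : Even n) (hn : n ≠ 0) (hdeg : 4 * H.maxDegree ≤ n + 2) :
    ((pathGraph n).boxProd H).IsHamiltonian := by
  intro _
  let r : ℕ → Fin n := fun i => ⟨i % n, Nat.mod_lt _ (Nat.pos_of_ne_zero hn)⟩
  obtain ⟨-, x, p, hp, hs, -⟩ := S.hasCycleOn_univ (P := pathGraph n) (r := r) hconn heven hn hdeg
    (fun i hi => by
      rw [pathGraph_adj]
      left
      simp only [r, Nat.mod_eq_of_lt hi, Nat.mod_eq_of_lt (Nat.lt_of_succ_lt hi)])
    (fun i hi j hj h => by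
      simpa [r, Nat.mod_eq_of_lt hi, Nat.mod_eq_of_lt hj] using h)
  refine ⟨x, p, ?_⟩
  refine Walk.isHamiltonianCycle_isCycle_and_isHamiltonian_tail.mpr
    ⟨hp, hp.isPath_tail.isHamiltonian_of_mem fun q => ?_⟩
  have hq : q ∈ p.support :=
    (hs q).mpr ⟨⟨q.1, q.1.2, by ext; simp [r, Nat.mod_eq_of_lt q.1.2]⟩, trivial⟩
  rw [Walk.support_tail_of_not_nil _ hp.not_nil]
  rcases (Walk.mem_support_iff _).mp hq with rfl | hq
  exacts [Walk.end_mem_tail_support hp.not_nil, hq]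

end ShortStarFactor

end SimpleGraph

theorem corollary1p5 {V : Type*} [Fintype V] [DecidableEq V] (H : SimpleGraph V)
    [DecidableRel H.Adj] (hconn : H.Connected) (hbip : H.IsBipartite)
    (n : ℕ) (heven : Even n) (hn : (n : ℤ) ≥ 4 * (H.maxDegree : ℤ) - 2)
    (hord : 3 ≤ n * Fintype.card V) :
    List.TFAE [
      ((SimpleGraph.pathGraph n).boxProd H).IsHamiltonian,
      ((SimpleGraph.pathGraph n).boxProd H).IsTough 1,
      ∃ F : SimpleGraph V, H.IsPathFactor F] := by
  tfae_have 1 → 2 := fun h => h.isTough_one (by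
    rw [Fintype.card_prod, Fintype.card_fin]
    omega)
  tfae_have 2 → 3 := fun h => by
    obtain ⟨f, hf, hadj⟩ := h.exists_injective heven hord hbip
    obtain ⟨S⟩ := hbip.nonempty_shortStarFactor hf hadj
    exact ⟨S.graph, S.isPathFactor_graph⟩
  tfae_have 3 → 1 := fun ⟨F, hF⟩ => by
    obtain ⟨f, hf, hadj⟩ := hF.exists_injective
    obtain ⟨S⟩ := hbip.nonempty_shortStarFactor hf hadj
    exact S.isHamiltonian_pathGraph_boxProd hconn heven (by rintro rfl; simp at hord) (by omega)
  tfae_finish
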